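/- For bounded operators $A_1,\dots,A_k$ on a complex Hilbert space let $\sigma_p(A_1,\dots,A_k)=\{x\in\mathbb C^k: x_1A_1+\dots+x_kA_k-I \text{ is not invertible}\}$. A point $x$ of $\sigma_p(A_1,\dots,A_k)$ is said to have multiplicity $m$ if $1$ is an isolated point of the spectrum of $A(x)=x_1A_1+\dots+x_kA_k$ and the spectral projection $\frac1{2\pi i}\int_{|w-1|=\rho}(w-A(x))^{-1}dw$ ($\rho>0$ small) has rank $m$. Let $\Delta_4(\tau,\epsilon)=\{w\in\mathbb C^4: |w_i-\tau_i|<\epsilon,\ i=1,\dots,4\}$. **Theorem.** Let $n\ge 1$ be an integer and $\omega=e^{2\pi i/n}$. Let $A$ be a bounded normal operator and $B$ a bounded operator of norm one on a complex Hilbert space $H$. Put $$S=\{(x,y,z_1,z_2)\in\mathbb C^4: x^n+y^n+(-1)^{n-1}(\omega z_1+z_2)^n=1\},$$ $\tau_{1j}=(\omega^j,0,0,0)$ and $\tau_{2j}=(0,\omega^j,0,0)$ for $j=0,\dots,n-1$. Suppose that there is an $\epsilon>0$ such that for $m=1,2$ and $j=0,\dots,n-1$ 1. $\sigma_p(A,B,AB,BA)\cap\Delta_4(\tau_{mj},\epsilon)=S\cap\Delta_4(\tau_{mj},\epsilon)$,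 and 2. every point of $S\cap\Delta_4(\tau_{mj},\epsilon)$ has multiplicity one in $\sigma_p(A,B,AB,BA)$. Then there is a subspace $L\subset H$ of dimension $n$, invariant under $A$ and $B$, such that (a) the pair $(A|_L,B|_L)$ is unitarily equivalent to the pair of $n\times n$ matrices $$\operatorname{diag}(1,\omega,\dots,\omega^{n-1}),\qquad \begin{bmatrix}0&0&\cdots&0&1\\1&0&\cdots&0&0\\0&1&\cdots&0&0\\ \vdots&&\ddots&&\vdots\\0&0&\cdots&1&0\end{bmatrix};$$ (b) $L$ has an orthonormal basis $e_0,\dots,e_{n-1}$ with $Ae_j=\omega^je_j$ and an orthonormal basis $\zeta_0,\dots,\zeta_{n-1}$ with $B\zeta_j=\omega^j\zeta_j$, and for any two such bases the matrix $C$ whose $k$-th column consists of the coefficients of $e_k$ in the basis $\zeta_0,\dots,\zeta_{n-1}$ satisfies $\sqrt n\,C=\Lambda_1F_n\Lambda_2$, where $F_n=[\omega^{jk}]_{j,k=0}^{n-1}$ and $\Lambda_1,\Lambda_2$ are diagonal matrices with unimodular diagonal entries. -/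

import Mathlib

open scoped Real

noncomputable section

/-- The proper projective joint spectrum of a tuple `T₁, …, T_k` of bounded operators: the set of
`x ∈ ℂᵏ` such that `x₁ T₁ + ⋯ + x_k T_k - I` is not invertible. -/
def properJointSpectrum {H : Type*} [NormedAddCommGroup H] [InnerProductSpace ℂ H] {k : ℕ}
    (T : Fin k → (H →L[ℂ] H)) : Set (Fin k → ℂ) :=
  {x | ¬ IsUnit (∑ i, x i • T i - 1)}

/-- The open polydisk of radius `r` centered at `x`. -/
def polydisk {k : ℕ} (x : Fin k → ℂ) (r : ℝ) : Set (Fin k → ℂ) :=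
  {w | ∀ i, ‖w i - x i‖ < r}

/-- The operator `(2πi)⁻¹ ∮ (w - S)⁻¹ dw`, the integral being over the circle `|w - c| = r`. -/
def rieszProjection {H : Type*} [NormedAddCommGroup H] [InnerProductSpace ℂ H]
    (S : H →L[ℂ] H) (c : ℂ) (r : ℝ) : H →L[ℂ] H :=
  (2 * π * Complex.I : ℂ)⁻¹ • circleIntegral (fun w : ℂ => resolvent S w) c r

/-- `c` is an isolated point of the spectrum of `S` and its (algebraic) multiplicity, the rank of
the corresponding spectral projection, is equal to `m`. -/
def IsIsolatedSpectralPointOfMultiplicity {H : Type*} [NormedAddCommGroup H]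
    [InnerProductSpace ℂ H] (S : H →L[ℂ] H) (c : ℂ) (m : ℕ) : Prop :=
  ∃ r : ℝ, 0 < r ∧ Metric.closedBall c r ∩ spectrum ℂ S = {c} ∧
    Module.rank ℂ (LinearMap.range (rieszProjection S c r).toLinearMap) = m

/-- The point `x` of the proper projective joint spectrum of `T₁, …, T_k` has multiplicity `m`:
`1` is an isolated point of multiplicity `m` of the spectrum of `x₁ T₁ + ⋯ + x_k T_k`. -/
def HasJointMultiplicity {H : Type*} [NormedAddCommGroup H] [InnerProductSpace ℂ H] {k : ℕ}
    (T : Fin k → (H →L[ℂ] H)) (x : Fin k → ℂ) (m : ℕ) : Prop :=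
  IsIsolatedSpectralPointOfMultiplicity (∑ i, x i • T i) 1 m

/-- The primitive root of unity `e^{2πi/n}`. -/
def rootOfUnity (n : ℕ) : ℂ := Complex.exp (2 * π * Complex.I / n)

/-- The surface `xⁿ + yⁿ + (-1)ⁿ⁻¹ (ω z₁ + z₂)ⁿ = 1` in `ℂ⁴`, where `ω = e^{2πi/n}`; the exponent
`n - 1` is only used for `n ≥ 1`. -/
def fourierSurface (n : ℕ) : Set (Fin 4 → ℂ) :=
  {p | p 0 ^ n + p 1 ^ n + (-1) ^ (n - 1) * (rootOfUnity n * p 2 + p 3) ^ n = 1}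

/-- The Fourier matrix `Fₙ`, with entries `ω ^ (j k)`, `0 ≤ j, k ≤ n - 1`. -/
def fourierMatrix (n : ℕ) : Matrix (Fin n) (Fin n) ℂ :=
  Matrix.of fun j k => rootOfUnity n ^ ((j : ℕ) * (k : ℕ))

/-- The matrix `diag (1, ω, …, ωⁿ⁻¹)`. -/
def clockMatrix (n : ℕ) : Matrix (Fin n) (Fin n) ℂ :=
  Matrix.diagonal fun j => rootOfUnity n ^ (j : ℕ)

/-- The matrix of the cyclic shift that sends the `k`-th basis vector to the `(k+1)`-st one and the
last basis vector to the first one. -/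
def shiftMatrix (n : ℕ) : Matrix (Fin n) (Fin n) ℂ :=
  Matrix.of fun j k => if (j : ℕ) = ((k : ℕ) + 1) % n then 1 else 0

/-- The pair of operators `(S, T)` on a space is unitarily equivalent to the pair of matrices
`(M, N)`. -/
def PairUnitarilyEquivalent {V : Type*} [NormedAddCommGroup V] [InnerProductSpace ℂ V] {n : ℕ}
    (S T : V →ₗ[ℂ] V) (M N : Matrix (Fin n) (Fin n) ℂ) : Prop :=
  ∃ U : V ≃ₗᵢ[ℂ] EuclideanSpace ℂ (Fin n),
    (∀ v, U (S v) = Matrix.toEuclideanLin M (U v)) ∧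
    (∀ v, U (T v) = Matrix.toEuclideanLin N (U v))

/-- `e₀, …, eₙ₋₁` is an orthonormal basis consisting of eigenvectors of `S` with
`S eⱼ = e^{2πij/n} eⱼ`. -/
def IsRootOfUnityEigenbasis {V : Type*} [NormedAddCommGroup V] [InnerProductSpace ℂ V] {n : ℕ}
    (S : V →ₗ[ℂ] V) (e : OrthonormalBasis (Fin n) ℂ V) : Prop :=
  ∀ j, S (e j) = rootOfUnity n ^ (j : ℕ) • e j

/-- The transition matrix from the basis `e` to the basis `ζ`: its `k`-th column consists of the
coefficients of the decomposition of `eₖ` in the basis `ζ₀, …, ζₙ₋₁`. -/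
def transitionMatrix {V : Type*} [NormedAddCommGroup V] [InnerProductSpace ℂ V] {n : ℕ}
    (e ζ : OrthonormalBasis (Fin n) ℂ V) : Matrix (Fin n) (Fin n) ℂ :=
  Matrix.of fun j k => ζ.repr (e k) j

end


/-!
At every point `(x₀, α, 0, -αx₀)` of the surface with `x₀ ^ n = 1` the pencil factors as
`1 - A(x) = (1 - αB)(1 - x₀A)`, so for small `α` its singularity there comes from the simple
eigenvalue `1` of `x₀A`. First-order perturbation of this eigenvalue along tangent vectors of the
surface, compared coefficientwise in the power series in `α`, gives `⟨e, Bⁿe⟩ = 1` and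
`⟨e, Bⁿ⁻¹ABe⟩ = ωμ` for every unit eigenvector `Ae = μe` with `μⁿ = 1`, where `μ = x₀⁻¹`.

Since `B` is a contraction, the equality case of the Cauchy–Schwarz inequality yields `Bⁿe = e` and
`(B*)ⁿ⁻¹e = Be`. The eigenvalues of `B` at the roots of unity being simple, `ker (Bⁿ - 1)` has
dimension at most `n` and is therefore spanned by the `n` eigenvectors of `A` found above, on which
`A` is isometric. As `Be` lies in this kernel, `‖ABe‖ = 1`, and the equality case now gives
`ABe = ωμBe`: the operator `B` permutes the eigenvectors of `A` cyclically.
-/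

open Filter Topology

section SingularPencil

variable {𝕜 E : Type*} [NontriviallyNormedField 𝕜] [NormedAddCommGroup E] [NormedSpace 𝕜 E]

theorem apply_inverse_apply {K : E →L[𝕜] E} (hK : IsUnit K) (v : E) :
    K (Ring.inverse K v) = v := by
  rw [← mul_apply_eq_comp, Ring.mul_inverse_cancel _ hK, one_apply_eq_self]

theorem inverse_apply_apply {K : E →L[𝕜] E} (hK : IsUnit K) (v : E) :
    Ring.inverse K (K v) = v := by
  rw [← mul_apply_eq_comp, Ring.inverse_mul_cancel _ hK, one_apply_eq_self]

theorem isUnit_one_sub_smulRight {φ : StrongDual 𝕜 E} {v : E} (h : φ v ≠ 1) :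
    IsUnit (1 - φ.smulRight v : E →L[𝕜] E) := by
  have h' : 1 - φ v ≠ 0 := sub_ne_zero.2 h.symm
  refine ⟨⟨_, 1 + (1 - φ v)⁻¹ • φ.smulRight v, ?_, ?_⟩, rfl⟩ <;> ext w <;>
    simp only [mul_apply_eq_comp, add_apply, sub_apply, one_apply_eq_self, smul_apply,
      ContinuousLinearMap.smulRight_apply, map_add, map_sub, map_smul] <;>
    match_scalars <;> field_simp <;> ring

theorem isUnit_sub_smulRight {K : E →L[𝕜] E} (hK : IsUnit K) {φ : StrongDual 𝕜 E} {f : E}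
    (h : φ (Ring.inverse K f) ≠ 1) : IsUnit (K - φ.smulRight f) := by
  have hfactor : K - φ.smulRight f = K * (1 - φ.smulRight (Ring.inverse K f)) := by
    ext w
    simp [apply_inverse_apply hK]
  rw [hfactor]
  exact hK.mul (isUnit_one_sub_smulRight h)

theorem apply_deriv_eq_zero_of_eventually_not_isUnit [CompleteSpace E] {M : 𝕜 → E →L[𝕜] E}
    {D : E →L[𝕜] E} (hM : HasDerivAt M D 0) {e f : E} {φ ψ : StrongDual 𝕜 E} (he : M 0 e = 0)
    (hφ : φ e = 1) (hψ : ∀ v, ψ (M 0 v) = 0) (hunit : IsUnit (M 0 + φ.smulRight f))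
    (hsing : ∀ᶠ t in 𝓝 0, ¬ IsUnit (M t)) : ψ (D e) = 0 := by
  set K : 𝕜 → E →L[𝕜] E := fun t => M t + φ.smulRight f with hK
  have hKderiv : HasDerivAt K D 0 := hM.add_const _
  set w : 𝕜 → E := fun t => Ring.inverse (K t) f
  have hw₀ : w 0 = e := by
    have hK₀ : K 0 e = f := by simp [hK, he, hφ]
    simpa [hK₀] using inverse_apply_apply (K := K 0) hunit e
  have hKunit : ∀ᶠ t in 𝓝 0, IsUnit (K t) :=
    hKderiv.continuousAt.eventually (Units.isOpen.mem_nhds hunit)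
  have hMw : (fun t => M t (w t)) =ᶠ[𝓝 0] fun _ => 0 := by
    filter_upwards [hKunit, hsing] with t ht hsing_t
    have hφw : φ (w t) = 1 := by
      by_contra hne
      exact hsing_t (by simpa [hK] using isUnit_sub_smulRight ht hne)
    have hKw : K t (w t) = f := apply_inverse_apply ht f
    simpa [hK, hφw] using hKw
  obtain ⟨w', hw'⟩ : ∃ w', HasDerivAt w w' 0 := by
    have hinv : DifferentiableAt 𝕜 (fun t => Ring.inverse (K t)) 0 :=
      DifferentiableAt.fun_comp' 0 (differentiableAt_inverse hunit) hKderiv.differentiableAt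
    exact ⟨_, (hinv.clm_apply (differentiableAt_const f)).hasDerivAt⟩
  have hsum : D e + M 0 w' = 0 := by
    have := (hM.clm_apply hw').unique ((hasDerivAt_const 0 (0 : E)).congr_of_eventuallyEq hMw)
    rwa [hw₀] at this
  simpa [hψ] using congrArg ψ hsum

/-- The number `1` is a simple eigenvalue of `S`, with eigenvector `e` and left eigenvector `φ`
normalized by `φ e = 1`. Simplicity is encoded by the requirement that the rank one perturbation
`v ↦ φ v • e` makes `1 - S` invertible. -/
structure IsSimpleFixedPair (S : E →L[𝕜] E) (φ : StrongDual 𝕜 E) (e : E) : Prop where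
  map_eq : S e = e
  dual_map_eq (v : E) : φ (S v) = φ v
  dual_eq_one : φ e = 1
  isUnit_one_sub_add_smulRight : IsUnit (1 - S + φ.smulRight e)

theorem IsSimpleFixedPair.apply_inverse_deriv_eq_zero [CompleteSpace E] {S N D : E →L[𝕜] E}
    {φ : StrongDual 𝕜 E} {e : E} (h : IsSimpleFixedPair S φ e) (hN : IsUnit N)
    {M : 𝕜 → E →L[𝕜] E} (hM : HasDerivAt M D 0) (hM₀ : M 0 = N * (1 - S))
    (hsing : ∀ᶠ t in 𝓝 0, ¬ IsUnit (M t)) : φ (Ring.inverse N (D e)) = 0 := by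
  have hfactor : M 0 + φ.smulRight (N e) = N * (1 - S + φ.smulRight e) := by
    ext v
    simp [hM₀]
  refine apply_deriv_eq_zero_of_eventually_not_isUnit (f := N e) (ψ := φ ∘L Ring.inverse N)
    hM ?_ h.dual_eq_one (fun v => ?_) ?_ hsing
  · simp [hM₀, h.map_eq]
  · simp [hM₀, inverse_apply_apply hN, h.dual_map_eq]
  · exact hfactor ▸ hN.mul h.isUnit_one_sub_add_smulRight

end SingularPencil

section Neumann

theorem coeff_eq_of_eventually_eq_pow_smul {𝕜 E : Type*} [NontriviallyNormedField 𝕜]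
    [NormedAddCommGroup E] [NormedSpace 𝕜 E] {f g : 𝕜 → E} {p : FormalMultilinearSeries 𝕜 𝕜 E}
    (hf : HasFPowerSeriesAt f p 0) (hg : ContinuousAt g 0) {m : ℕ}
    (h : ∀ᶠ z in 𝓝 0, f z = z ^ m • g z) : p.coeff m = g 0 := by
  induction m generalizing f p with
  | zero =>
    rw [← one_smul 𝕜 (g 0), ← pow_zero (0 : 𝕜), ← h.self_of_nhds]
    exact hf.coeff_zero _
  | succ m ih =>
    have hf₀ : f 0 = 0 := by simpa using h.self_of_nhds
    rw [← FormalMultilinearSeries.coeff_fslope]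
    have hslope := hf.has_fpower_series_dslope_fslope
    refine ih hslope (hslope.continuousAt.eventuallyEq_nhds_iff_eventuallyEq_nhdsNE ?_ |>.1 ?_)
    · exact (continuousAt_id.pow m).smul hg
    · filter_upwards [h.filter_mono nhdsWithin_le_nhds, self_mem_nhdsWithin] with z hz hz₀
      rw [dslope_of_ne _ hz₀, slope_def_module, hf₀, hz, sub_zero, sub_zero, smul_smul, pow_succ',
        inv_mul_cancel_left₀ hz₀]

theorem apply_pow_eq_of_eventually_apply_inverse_eq {𝕜 E : Type*} [NontriviallyNormedField 𝕜]
    [NormedAddCommGroup E] [NormedSpace 𝕜 E] [CompleteSpace E] {B : E →L[𝕜] E}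
    {φ : StrongDual 𝕜 E} {u v : E} {m : ℕ}
    (h : ∀ᶠ z in 𝓝 (0 : 𝕜),
      φ (Ring.inverse (1 - z • B : E →L[𝕜] E) v) =
        z ^ m * φ (Ring.inverse (1 - z • B : E →L[𝕜] E) u)) :
    φ ((B ^ m) v) = φ u := by
  have hseries (w : E) := (φ ∘L ContinuousLinearMap.apply 𝕜 E w).comp_hasFPowerSeriesOnBall
    (spectrum.hasFPowerSeriesOnBall_inverse_one_sub_smul 𝕜 B) |>.hasFPowerSeriesAt
  have hcoeff := coeff_eq_of_eventually_eq_pow_smul (hseries v) (hseries u).continuousAt h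
  change φ (ContinuousMultilinearMap.mkPiRing 𝕜 (Fin m) (B ^ m) 1 v) = _ at hcoeff
  simpa using hcoeff

end Neumann

section FourierSurface

variable {H : Type*} [NormedAddCommGroup H] [InnerProductSpace ℂ H]

theorem IsSimpleFixedPair.sum_mul_apply_inverse_eq_zero [CompleteSpace H] {k : ℕ}
    {T : Fin k → H →L[ℂ] H} {S N : H →L[ℂ] H} {φ : StrongDual ℂ H} {e : H}
    (h : IsSimpleFixedPair S φ e) (hN : IsUnit N) {c : ℂ → Fin k → ℂ} {d : Fin k → ℂ}
    (hc : HasDerivAt c d 0) (hc₀ : 1 - ∑ i, c 0 i • T i = N * (1 - S))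
    (hsing : ∀ᶠ t in 𝓝 0, c t ∈ properJointSpectrum T) :
    ∑ i, d i * φ (Ring.inverse N (T i e)) = 0 := by
  have hderiv : HasDerivAt (fun t => 1 - ∑ i, c t i • T i) (-∑ i, d i • T i) 0 :=
    (HasDerivAt.fun_sum fun i _ => ((hasDerivAt_pi.1 hc i).smul_const (T i))).const_sub 1
  have hzero := h.apply_inverse_deriv_eq_zero hN hderiv hc₀ <| hsing.mono fun t ht hunit =>
    ht (by simpa using hunit.neg)
  simpa using hzero

theorem hasDerivAt_mul_one_sub_cpow {n : ℕ} (hn : n ≠ 0) (x₀ : ℂ) {g : ℂ → ℂ} {g' : ℂ}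
    (hg : HasDerivAt g (n * g') 0) (hg₀ : g 0 = 0) :
    HasDerivAt (fun t => x₀ * (1 - g t) ^ ((n : ℂ)⁻¹)) (-(x₀ * g')) 0 := by
  have hn' : (n : ℂ) ≠ 0 := Nat.cast_ne_zero.2 hn
  have hroot := ((hg.const_sub 1).cpow_const (c := (n : ℂ)⁻¹) (by simp [hg₀])).const_mul x₀
  refine hroot.congr_deriv ?_
  simp only [hg₀, sub_zero, Complex.one_cpow]
  field_simp

theorem exists_hasDerivAt_mem_fourierSurface {n : ℕ} (hn : n ≠ 0) {x₀ : ℂ} (hx₀ : x₀ ^ n = 1)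
    (α a b : ℂ) :
    ∃ c : ℂ → Fin 4 → ℂ, (∀ t, c t ∈ fourierSurface n) ∧ c 0 = ![x₀, α, 0, -(α * x₀)] ∧
      HasDerivAt c ![-(x₀ * (α ^ (n - 1) * a + (α * x₀) ^ (n - 1) * rootOfUnity n * b)), a, b, 0]
        0 := by
  set ω := rootOfUnity n
  have hsign (m : ℕ) : ((-1 : ℂ)) ^ m * (-1) ^ m = 1 := by simp [← mul_pow]
  let g : ℂ → ℂ := fun t =>
    (α + t * a) ^ n + (-1) ^ (n - 1) * (ω * (t * b) + -(α * x₀)) ^ n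
  have hg₀ : g 0 = 0 := by
    obtain ⟨m, rfl⟩ := Nat.exists_eq_add_one_of_ne_zero hn
    simp only [g, Nat.add_sub_cancel, zero_mul, add_zero, mul_zero, zero_add,
      neg_pow (α * x₀), mul_pow, hx₀]
    linear_combination -α ^ (m + 1) * hsign m
  have hline (p q : ℂ) : HasDerivAt (fun t => p + t * q) q 0 := by
    simpa using ((hasDerivAt_id (0 : ℂ)).mul_const q).const_add p
  have hg : HasDerivAt g (n * (α ^ (n - 1) * a + (α * x₀) ^ (n - 1) * ω * b)) 0 := by
    have hz : HasDerivAt (fun t => ω * (t * b) + -(α * x₀)) (ω * b) 0 := by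
      simpa using ((hline 0 b).const_mul ω).add_const (-(α * x₀))
    refine (((hline α a).fun_pow n).add ((hz.fun_pow n).const_mul _)).congr_deriv ?_
    simp only [zero_mul, add_zero, mul_zero, zero_add, neg_pow (α * x₀)]
    linear_combination n * (α * x₀) ^ (n - 1) * ω * b * hsign (n - 1)
  refine ⟨fun t => ![x₀ * (1 - g t) ^ ((n : ℂ)⁻¹), α + t * a, t * b, -(α * x₀)],
    fun t => ?_, by simp [hg₀], hasDerivAt_pi.2 fun i => ?_⟩
  · have hroot : (x₀ * (1 - g t) ^ ((n : ℂ)⁻¹)) ^ n = 1 - g t := by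
      rw [mul_pow, hx₀, one_mul, Complex.cpow_nat_inv_pow _ hn]
    simp only [fourierSurface, Set.mem_ofPred_eq, Matrix.cons_val, hroot]
    ring
  · fin_cases i
    · exact hasDerivAt_mul_one_sub_cpow hn x₀ hg hg₀
    · exact hline α a
    · simpa using hline 0 b
    · exact hasDerivAt_const _ _

variable [CompleteSpace H] {A B : H →L[ℂ] H} {n : ℕ} {x₀ : ℂ} {φ : StrongDual ℂ H} {e : H}

theorem IsSimpleFixedPair.eventually_apply_inverse_eq (hn : n ≠ 0) (hx₀ : x₀ ^ n = 1)
    (h : IsSimpleFixedPair (x₀ • A) φ e)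
    (hspec : ∀ᶠ p in 𝓝 ![x₀, 0, 0, 0], p ∈ fourierSurface n →
      p ∈ properJointSpectrum ![A, B, A * B, B * A]) :
    ∀ᶠ α in 𝓝 (0 : ℂ), ∀ a b : ℂ,
      a * φ (Ring.inverse (1 - α • B : H →L[ℂ] H) (B e)) +
          b * φ (Ring.inverse (1 - α • B : H →L[ℂ] H) (A (B e))) =
        (α ^ (n - 1) * a + (α * x₀) ^ (n - 1) * rootOfUnity n * b) *
          φ (Ring.inverse (1 - α • B : H →L[ℂ] H) e) := by
  have hbase : Tendsto (fun α : ℂ => ![x₀, α, 0, -(α * x₀)]) (𝓝 0) (𝓝 ![x₀, 0, 0, 0]) :=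
    (by fun_prop : Continuous fun α : ℂ => ![x₀, α, 0, -(α * x₀)]).tendsto' _ _ (by simp)
  have hunit : ∀ᶠ α in 𝓝 (0 : ℂ), IsUnit (1 - α • B) := by
    have : ContinuousAt (fun α : ℂ => 1 - α • B) 0 := by fun_prop
    exact this.eventually (Units.isOpen.mem_nhds (by simp))
  have hspec' : ∀ᶠ α in 𝓝 (0 : ℂ), ∀ᶠ p in 𝓝 ![x₀, α, 0, -(α * x₀)],
      p ∈ fourierSurface n → p ∈ properJointSpectrum ![A, B, A * B, B * A] :=
    hbase.eventually hspec.eventually_nhds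
  filter_upwards [hunit, hspec'] with α hα hαspec a b
  obtain ⟨c, hcmem, hc₀, hc⟩ := exists_hasDerivAt_mem_fourierSurface hn hx₀ α a b
  -- The base points `(x₀, α, 0, -αx₀)` are chosen to make this factorization hold.
  have hfactor : 1 - ∑ i, c 0 i • (![A, B, A * B, B * A] : Fin 4 → H →L[ℂ] H) i =
      (1 - α • B) * (1 - x₀ • A) := by
    simp only [hc₀, Fin.sum_univ_four, Matrix.cons_val, sub_mul, mul_sub, one_mul, mul_one,
      smul_mul_smul_comm, zero_smul, neg_smul]
    abel
  have hsing : ∀ᶠ t in 𝓝 0, c t ∈ properJointSpectrum ![A, B, A * B, B * A] :=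
    (hc.continuousAt.eventually (hc₀ ▸ hαspec)).mono fun t ht => ht (hcmem t)
  have hsum := h.sum_mul_apply_inverse_eq_zero hα hc hfactor hsing
  have hAe : x₀ * φ (Ring.inverse (1 - α • B) (A e)) = φ (Ring.inverse (1 - α • B) e) := by
    simpa using congrArg (fun v => φ (Ring.inverse (1 - α • B) v)) h.map_eq
  simp only [Fin.sum_univ_four, Matrix.cons_val, mul_apply_eq_comp, zero_mul] at hsum
  linear_combination hsum + (α ^ (n - 1) * a + (α * x₀) ^ (n - 1) * rootOfUnity n * b) * hAe

theorem IsSimpleFixedPair.apply_pow_eq_one (hn : n ≠ 0) (hx₀ : x₀ ^ n = 1)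
    (h : IsSimpleFixedPair (x₀ • A) φ e)
    (hspec : ∀ᶠ p in 𝓝 ![x₀, 0, 0, 0], p ∈ fourierSurface n →
      p ∈ properJointSpectrum ![A, B, A * B, B * A]) :
    φ ((B ^ n) e) = 1 := by
  have hB : φ ((B ^ (n - 1)) (B e)) = φ e :=
    apply_pow_eq_of_eventually_apply_inverse_eq <|
      (h.eventually_apply_inverse_eq hn hx₀ hspec).mono fun α hα => by simpa using hα 1 0
  rwa [← mul_apply_eq_comp, pow_sub_one_mul hn, h.dual_eq_one] at hB

theorem IsSimpleFixedPair.apply_pow_sub_one_apply_eq (hn : n ≠ 0) (hx₀ : x₀ ^ n = 1)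
    (h : IsSimpleFixedPair (x₀ • A) φ e)
    (hspec : ∀ᶠ p in 𝓝 ![x₀, 0, 0, 0], p ∈ fourierSurface n →
      p ∈ properJointSpectrum ![A, B, A * B, B * A]) :
    φ ((B ^ (n - 1)) (A (B e))) = x₀ ^ (n - 1) * rootOfUnity n := by
  have hAB : φ ((B ^ (n - 1)) (A (B e))) = φ ((x₀ ^ (n - 1) * rootOfUnity n) • e) :=
    apply_pow_eq_of_eventually_apply_inverse_eq <|
      (h.eventually_apply_inverse_eq hn hx₀ hspec).mono fun α hα => by
        simpa [mul_pow, mul_assoc] using hα 0 1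
  simpa [h.dual_eq_one] using hAB

end FourierSurface

section IsolatedSpectrum

theorem rieszProjection_apply_of_apply_eq_smul {H : Type*} [NormedAddCommGroup H]
    [InnerProductSpace ℂ H] [CompleteSpace H] {S : H →L[ℂ] H} {c μ : ℂ} {r : ℝ} {v : H}
    (hμ : μ ∈ Metric.ball c r) (hres : Metric.sphere c r ⊆ resolventSet ℂ S)
    (hv : S v = μ • v) : rieszProjection S c r v = v := by
  have hr : 0 < r := dist_nonneg.trans_lt hμ
  have hint : CircleIntegrable (resolvent S) c r := by
    refine ContinuousOn.circleIntegrable hr.le fun w hw => ?_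
    exact (spectrum.hasDerivAt_resolvent_const_left (hres hw)).continuousAt.continuousWithinAt
  have hresolvent : ∀ w ∈ Metric.sphere c r, resolvent S w v = (w - μ)⁻¹ • v := by
    intro w hw
    have hwμ : w - μ ≠ 0 := sub_ne_zero.2 fun h =>
      (Metric.mem_ball.1 hμ).ne (h ▸ Metric.mem_sphere.1 hw)
    have hwv : (algebraMap ℂ (H →L[ℂ] H) w - S) v = (w - μ) • v := by
      simp [Algebra.algebraMap_eq_smul_one, hv, sub_smul]
    rw [eq_inv_smul_iff₀ hwμ, ← map_smul, ← hwv]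
    exact inverse_apply_apply (hres hw) v
  have happly : circleIntegral (resolvent S) c r v = ∮ w in C(c, r), resolvent S w v := by
    simpa [circleIntegral] using (ContinuousLinearMap.intervalIntegral_comp_comm
      (ContinuousLinearMap.apply ℂ H v) hint.out).symm
  rw [rieszProjection, smul_apply, happly, circleIntegral.integral_congr hr.le hresolvent,
    circleIntegral.integral_smul_const, circleIntegral.integral_sub_inv_of_mem_ball hμ, smul_smul,
    inv_mul_cancel₀ Complex.two_pi_I_ne_zero, one_smul]

namespace IsIsolatedSpectralPointOfMultiplicity

variable {H : Type*} [NormedAddCommGroup H] [InnerProductSpace ℂ H] {S : H →L[ℂ] H} {c : ℂ}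
  {m : ℕ}

theorem mem_spectrum (h : IsIsolatedSpectralPointOfMultiplicity S c m) : c ∈ spectrum ℂ S := by
  obtain ⟨r, -, hspec, -⟩ := h
  exact (hspec.ge rfl).2

theorem eventually_eq (h : IsIsolatedSpectralPointOfMultiplicity S c m) :
    ∀ᶠ z in 𝓝[spectrum ℂ S] c, z = c := by
  obtain ⟨r, hr, hspec, -⟩ := h
  filter_upwards [self_mem_nhdsWithin,
    mem_nhdsWithin_of_mem_nhds (Metric.closedBall_mem_nhds c hr)] with z hz hzr
  exact hspec.le ⟨hzr, hz⟩

theorem rank_eigenspace_le [CompleteSpace H] (h : IsIsolatedSpectralPointOfMultiplicity S c m) :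
    Module.rank ℂ (Module.End.eigenspace S.toLinearMap c) ≤ m := by
  obtain ⟨r, hr, hspec, hrank⟩ := h
  have hres : Metric.sphere c r ⊆ resolventSet ℂ S := by
    intro w hw
    by_contra hwS
    have hwc : w = c := hspec.le ⟨Metric.sphere_subset_closedBall hw, hwS⟩
    exact hr.ne (by simpa [hwc] using hw)
  rw [← hrank]
  refine Submodule.rank_mono fun v hv => ⟨v, ?_⟩
  exact rieszProjection_apply_of_apply_eq_smul (Metric.mem_ball_self hr) hres
    (Module.End.mem_eigenspace_iff.1 hv)

end IsIsolatedSpectralPointOfMultiplicity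

theorem exists_isStarProjection_of_eventually_eq {𝒜 : Type*} [CStarAlgebra 𝒜] {S : 𝒜}
    [IsStarNormal S] {c : ℂ} (hc : ∀ᶠ z in 𝓝[spectrum ℂ S] c, z = c) :
    ∃ Q : 𝒜, IsStarProjection Q ∧ (algebraMap ℂ 𝒜 c - S) * Q = 0 ∧
      IsUnit (algebraMap ℂ 𝒜 c - S + Q) := by
  let χ : ℂ → ℂ := fun z => if z = c then 1 else 0
  have hχ : ContinuousOn χ (spectrum ℂ S) := by
    intro z _
    by_cases hzc : z = c
    · subst hzc
      have hχ_one : χ =ᶠ[𝓝[spectrum ℂ S] z] fun _ => 1 := hc.mono fun w hw => if_pos hw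
      exact continuousWithinAt_const.congr_of_eventuallyEq hχ_one (if_pos rfl)
    · have hχ_zero : χ =ᶠ[𝓝 z] fun _ => 0 :=
        (isOpen_ne.eventually_mem hzc).mono fun w hw => if_neg hw
      exact (continuousAt_const.congr hχ_zero.symm).continuousWithinAt
  have hsub : cfc (fun z => c - z) S = algebraMap ℂ 𝒜 c - S := by
    rw [cfc_sub (fun _ => c) (fun z => z) S, cfc_const c S, cfc_id' ℂ S]
  refine ⟨cfc χ S, ⟨?_, ?_⟩, ?_, ?_⟩
  · rw [IsIdempotentElem, ← cfc_mul χ χ S]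
    congr! 2 with z
    simp [χ]
  · rw [IsSelfAdjoint, ← cfc_star]
    congr! 2 with z
    simp [χ, apply_ite]
  · rw [← hsub, ← cfc_mul _ χ S, ← cfc_const_zero ℂ S]
    congr! 2 with z
    simp +contextual [χ, eq_comm]
  · rw [← hsub, ← cfc_add S _ χ, isUnit_cfc_iff _ S]
    intro z _
    by_cases hzc : z = c
    · simp [χ, hzc]
    · simpa [χ, hzc, sub_eq_zero] using Ne.symm hzc

end IsolatedSpectrum

section NormalOperator

theorem exists_smul_eq_of_rank_le_one {K V : Type*} [Field K] [AddCommGroup V] [Module K V]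
    {W : Submodule K V} (hW : Module.rank K W ≤ 1) {e v : V} (he₀ : e ≠ 0) (he : e ∈ W)
    (hv : v ∈ W) : ∃ d : K, d • e = v := by
  obtain ⟨u, hu⟩ := (rank_submodule_le_one_iff' W).1 hW
  obtain ⟨a, rfl⟩ := Submodule.mem_span_singleton.1 (hu he)
  obtain ⟨b, rfl⟩ := Submodule.mem_span_singleton.1 (hu hv)
  exact ⟨b / a, by rw [smul_smul, div_mul_cancel₀ b (left_ne_zero_of_smul he₀)]⟩

variable {H : Type*} [NormedAddCommGroup H] [InnerProductSpace ℂ H] [CompleteSpace H]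
  {S : H →L[ℂ] H} [IsStarNormal S]

theorem inner_apply_eq_of_apply_eq_smul {e : H} {c : ℂ} (he : S e = c • e) (v : H) :
    inner ℂ e (S v) = c * inner ℂ e v := by
  have hnormal : IsStarNormal (S - c • 1 : H →L[ℂ] H) :=
    Commute.isStarNormal_sub (by simpa using (Commute.one_right S).smul_right _)
  have hadj : ContinuousLinearMap.adjoint (S - c • 1) e = 0 :=
    (ContinuousLinearMap.IsStarNormal.adjoint_apply_eq_zero_iff hnormal e).2 (by simp [he])
  have hzero : inner ℂ e ((S - c • 1) v) = 0 := by
    rw [← ContinuousLinearMap.adjoint_inner_left, hadj, inner_zero_left]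
  simpa [inner_sub_right, inner_smul_right, sub_eq_zero] using hzero

theorem orthonormal_of_apply_eq_smul {ι : Type*} {v : ι → H} {c : ι → ℂ}
    (hc : Function.Injective c) (hv : ∀ i, ‖v i‖ = 1) (hSv : ∀ i, S (v i) = c i • v i) :
    Orthonormal ℂ v := by
  refine ⟨hv, fun i j hij => ?_⟩
  have h := inner_apply_eq_of_apply_eq_smul (hSv i) (v j)
  rw [hSv j, inner_smul_right] at h
  have : (c j - c i) * inner ℂ (v i) (v j) = 0 := by linear_combination h
  exact (mul_eq_zero.1 this).resolve_left (sub_ne_zero.2 (hc.ne hij.symm))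

theorem exists_norm_eq_one_apply_eq_smul {c : ℂ} (hc : c ∈ spectrum ℂ S)
    (hiso : ∀ᶠ z in 𝓝[spectrum ℂ S] c, z = c) : ∃ e : H, ‖e‖ = 1 ∧ S e = c • e := by
  obtain ⟨Q, -, hSQ, hunit⟩ := exists_isStarProjection_of_eventually_eq hiso
  have hSQ_apply (v : H) : c • Q v - S (Q v) = 0 := by
    simpa [Algebra.algebraMap_eq_smul_one] using DFunLike.congr_fun hSQ v
  obtain ⟨v, hv⟩ : ∃ v, Q v ≠ 0 := by
    by_contra! hQ
    rw [show Q = 0 from ContinuousLinearMap.ext hQ, add_zero] at hunit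
    exact hc hunit
  refine ⟨(‖Q v‖⁻¹ : ℂ) • Q v, by simp [norm_smul, hv], ?_⟩
  rw [map_smul, ← sub_eq_zero.1 (hSQ_apply v), smul_comm]

theorem isSimpleFixedPair_innerSL (hiso : ∀ᶠ z in 𝓝[spectrum ℂ S] 1, z = 1)
    (hrank : Module.rank ℂ (Module.End.eigenspace S.toLinearMap 1) ≤ 1) {e : H} (he : ‖e‖ = 1)
    (hSe : S e = e) : IsSimpleFixedPair S (innerSL ℂ e) e := by
  obtain ⟨Q, hQ, hSQ, hunit⟩ := exists_isStarProjection_of_eventually_eq hiso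
  rw [map_one] at hSQ hunit
  have hQe : Q e = e := by
    apply (ContinuousLinearMap.isUnit_iff_bijective.1 hunit).injective
    have hSQe : (1 - S) (Q e) = 0 := DFunLike.congr_fun hSQ e
    have hQQe : Q (Q e) = Q e := DFunLike.congr_fun hQ.isIdempotentElem.eq e
    rw [add_apply, add_apply, hSQe, hQQe]
    simp [hSe]
  have hQv (v : H) : ∃ d : ℂ, d • e = Q v := by
    have hSQv : (1 - S) (Q v) = 0 := DFunLike.congr_fun hSQ v
    refine exists_smul_eq_of_rank_le_one hrank (norm_ne_zero_iff.1 (he ▸ one_ne_zero)) ?_ ?_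
    · simpa using hSe
    · simpa using (sub_eq_zero.1 hSQv).symm
  have hQ_eq : Q = (innerSL ℂ e).smulRight e := by
    ext v
    obtain ⟨d, hd⟩ := hQv v
    have hinner : inner ℂ e (Q v) = inner ℂ e v := by
      rw [← ContinuousLinearMap.adjoint_inner_left, ← ContinuousLinearMap.star_eq_adjoint,
        hQ.isSelfAdjoint.star_eq, hQe]
    simp [← hinner, ← hd, he]
  have hφ (v : H) : inner ℂ e (S v) = inner ℂ e v := by
    simpa using inner_apply_eq_of_apply_eq_smul (c := 1) (by simpa using hSe) v
  exact ⟨hSe, hφ, by simp [he], hQ_eq ▸ hunit⟩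

end NormalOperator

section Contraction

theorem eq_smul_of_inner_eq {𝕜 E : Type*} [RCLike 𝕜] [NormedAddCommGroup E]
    [InnerProductSpace 𝕜 E] {f v : E} {c : 𝕜} (hf : ‖f‖ = 1) (hv : ‖v‖ ≤ 1) (hc : ‖c‖ = 1)
    (h : inner 𝕜 f v = c) : v = c • f := by
  have hinner : inner 𝕜 v (c • f) = 1 := by
    rw [inner_smul_right, ← inner_conj_symm, h, RCLike.mul_conj, hc]
    simp
  have hsub := norm_sub_sq (𝕜 := 𝕜) v (c • f)
  rw [hinner, norm_smul, hc, hf, RCLike.one_re] at hsub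
  have hzero : ‖v - c • f‖ = 0 := by nlinarith [norm_nonneg v, norm_nonneg (v - c • f)]
  exact sub_eq_zero.1 (norm_eq_zero.1 hzero)

theorem norm_apply_eq_of_mem_span {𝕜 E ι : Type*} [RCLike 𝕜] [NormedAddCommGroup E]
    [InnerProductSpace 𝕜 E] [Finite ι] {v : ι → E} (hv : Orthonormal 𝕜 v) {T : E →ₗ[𝕜] E}
    {c : ι → 𝕜} (hc : ∀ i, ‖c i‖ = 1) (hT : ∀ i, T (v i) = c i • v i) {x : E}
    (hx : x ∈ Submodule.span 𝕜 (Set.range v)) : ‖T x‖ = ‖x‖ := by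
  have := Fintype.ofFinite ι
  obtain ⟨a, rfl⟩ := (Submodule.mem_span_range_iff_exists_fun 𝕜).1 hx
  have hTx : T (∑ i, a i • v i) = ∑ i, (a i * c i) • v i := by simp [hT, smul_smul]
  have hcc (i : ι) : (starRingEnd 𝕜) (c i) * c i = 1 := by simp [RCLike.conj_mul, hc]
  rw [hTx, norm_eq_sqrt_re_inner (𝕜 := 𝕜), norm_eq_sqrt_re_inner (𝕜 := 𝕜), hv.inner_sum,
    hv.inner_sum]
  congr! 3 with i
  rw [map_mul]
  linear_combination (starRingEnd 𝕜) (a i) * a i * hcc i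

variable {H : Type*} [NormedAddCommGroup H] [InnerProductSpace ℂ H] {A B : H →L[ℂ] H} {e : H}
  {n : ℕ}

theorem norm_pow_le_one (hB : ‖B‖ ≤ 1) (n : ℕ) : ‖B ^ n‖ ≤ 1 := by
  cases n with
  | zero => exact ContinuousLinearMap.norm_id_le
  | succ m => exact (norm_pow_le' B m.succ_pos).trans (pow_le_one₀ (norm_nonneg B) hB)

theorem pow_apply_eq_self_of_inner_eq_one (hB : ‖B‖ ≤ 1) (he : ‖e‖ = 1)
    (h : inner ℂ e ((B ^ n) e) = (1 : ℂ)) : (B ^ n) e = e := by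
  have hnorm : ‖(B ^ n) e‖ ≤ 1 := by
    simpa using (B ^ n).le_of_opNorm_le_of_le (norm_pow_le_one hB n) he.le
  simpa using eq_smul_of_inner_eq he hnorm norm_one h

theorem norm_apply_eq_one_of_inner_pow_apply_eq_one (hn : n ≠ 0) (hB : ‖B‖ ≤ 1) (he : ‖e‖ = 1)
    (h : inner ℂ e ((B ^ n) e) = (1 : ℂ)) : ‖B e‖ = 1 := by
  have hle {T : H →L[ℂ] H} (hT : ‖T‖ ≤ 1) (v : H) : ‖T v‖ ≤ ‖v‖ := by
    simpa using T.le_of_opNorm_le hT v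
  refine le_antisymm ((hle hB e).trans_eq he) ?_
  calc 1 = ‖(B ^ (n - 1)) (B e)‖ := by
        rw [← mul_apply_eq_comp, pow_sub_one_mul hn, pow_apply_eq_self_of_inner_eq_one hB he h, he]
    _ ≤ ‖B e‖ := hle (norm_pow_le_one hB (n - 1)) (B e)

theorem adjoint_pow_sub_one_apply_eq [CompleteSpace H] (hn : n ≠ 0) (hB : ‖B‖ ≤ 1)
    (he : ‖e‖ = 1) (h : inner ℂ e ((B ^ n) e) = (1 : ℂ)) :
    ContinuousLinearMap.adjoint (B ^ (n - 1)) e = B e := by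
  have hBe := norm_apply_eq_one_of_inner_pow_apply_eq_one hn hB he h
  have hnorm : ‖ContinuousLinearMap.adjoint (B ^ (n - 1)) e‖ ≤ 1 := by
    rw [← mul_one (1 : ℝ)]
    refine ContinuousLinearMap.le_of_opNorm_le_of_le _ ?_ he.le
    exact (ContinuousLinearMap.adjoint.norm_map _).trans_le (norm_pow_le_one hB _)
  have hinner : inner ℂ (B e) (ContinuousLinearMap.adjoint (B ^ (n - 1)) e) = (1 : ℂ) := by
    rw [ContinuousLinearMap.adjoint_inner_right, ← mul_apply_eq_comp, pow_sub_one_mul hn,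
      ← inner_conj_symm, h, map_one]
  simpa using eq_smul_of_inner_eq hBe hnorm norm_one hinner

theorem apply_apply_eq_smul_of_inner_eq [CompleteSpace H] (hn : n ≠ 0) (hB : ‖B‖ ≤ 1)
    (he : ‖e‖ = 1) (h : inner ℂ e ((B ^ n) e) = (1 : ℂ)) (hA : ‖A (B e)‖ ≤ 1) {c : ℂ}
    (hc : ‖c‖ = 1) (hAB : inner ℂ e ((B ^ (n - 1)) (A (B e))) = c) : A (B e) = c • B e := by
  refine eq_smul_of_inner_eq (norm_apply_eq_one_of_inner_pow_apply_eq_one hn hB he h) hA hc ?_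
  rw [← hAB, ← ContinuousLinearMap.adjoint_inner_left (B ^ (n - 1)),
    adjoint_pow_sub_one_apply_eq hn hB he h]

end Contraction

section RootsOfUnity

open Polynomial

theorem rank_ker_aeval_prod_X_sub_C_le {K V : Type*} [Field K] [AddCommGroup V] [Module K V]
    (f : Module.End K V) (s : Finset K) :
    Module.rank K (LinearMap.ker (aeval f (∏ c ∈ s, (X - C c)))) ≤
      ∑ c ∈ s, Module.rank K (f.eigenspace c) := by
  classical
  induction s using Finset.induction_on with
  | empty => rw [Finset.prod_empty, map_one, Module.End.one_eq_id, LinearMap.ker_id]; simp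
  | insert c s hc ih =>
    have hcoprime : IsCoprime (X - C c) (∏ d ∈ s, (X - C d)) :=
      IsCoprime.prod_right fun d hd => isCoprime_X_sub_C_of_isUnit_sub
        (sub_ne_zero.2 (ne_of_mem_of_not_mem hd hc).symm).isUnit
    have hker : LinearMap.ker (aeval f (X - C c)) = f.eigenspace c := by
      rw [Module.End.eigenspace_def, map_sub, aeval_X, aeval_C, Algebra.algebraMap_eq_smul_one]
    rw [Finset.prod_insert hc, Finset.sum_insert hc,
      ← sup_ker_aeval_eq_ker_aeval_mul_of_coprime f hcoprime, hker]
    exact (Submodule.rank_add_le_rank_add_rank _ _).trans (add_le_add_right ih _)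

theorem rank_ker_pow_sub_one_le {K V : Type*} [Field K] [AddCommGroup V] [Module K V]
    {f : Module.End K V} {n : ℕ} (hn : n ≠ 0) {ω : K} (hω : IsPrimitiveRoot ω n)
    (hf : ∀ c : K, c ^ n = 1 → Module.rank K (f.eigenspace c) ≤ 1) :
    Module.rank K (LinearMap.ker (f ^ n - 1)) ≤ n := by
  have hpos := Nat.pos_of_ne_zero hn
  have hker : f ^ n - 1 = aeval f (∏ c ∈ nthRootsFinset n (1 : K), (X - C c)) := by
    simp [← X_pow_sub_one_eq_prod hpos hω]
  calc Module.rank K (LinearMap.ker (f ^ n - 1))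
      ≤ ∑ c ∈ nthRootsFinset n (1 : K), Module.rank K (f.eigenspace c) :=
        hker ▸ rank_ker_aeval_prod_X_sub_C_le f _
    _ ≤ ∑ _c ∈ nthRootsFinset n (1 : K), 1 :=
        Finset.sum_le_sum fun c hc => hf c ((mem_nthRootsFinset hpos 1).1 hc)
    _ = n := by simp [hω.card_nthRootsFinset]

end RootsOfUnity

section Invariance

theorem span_range_eq_of_rank_le {K V ι : Type*} [Field K] [AddCommGroup V] [Module K V]
    [Fintype ι] {v : ι → V} (hv : LinearIndependent K v) {W : Submodule K V}
    (hvW : ∀ i, v i ∈ W) (hW : Module.rank K W ≤ Fintype.card ι) :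
    Submodule.span K (Set.range v) = W := by
  have : Module.Finite K W :=
    Module.rank_lt_aleph0_iff.1 (hW.trans_lt (Cardinal.natCast_lt_aleph0))
  refine Submodule.eq_of_le_of_finrank_le (Submodule.span_le.2 (Set.range_subset_iff.2 hvW)) ?_
  rw [finrank_span_eq_card hv]
  exact Module.finrank_le_of_rank_le hW

theorem norm_apply_eq_of_rank_ker_pow_sub_one_le {H : Type*} [NormedAddCommGroup H]
    [InnerProductSpace ℂ H] {S T : Module.End ℂ H} {n : ℕ}
    (hT : Module.rank ℂ (LinearMap.ker (T ^ n - 1)) ≤ n) {v : Fin n → H} (hv : Orthonormal ℂ v)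
    {c : Fin n → ℂ} (hc : ∀ i, ‖c i‖ = 1) (hSv : ∀ i, S (v i) = c i • v i)
    (hTv : ∀ i, (T ^ n) (v i) = v i) {x : H} (hx : (T ^ n) x = x) : ‖S x‖ = ‖x‖ := by
  have hspan : Submodule.span ℂ (Set.range v) = LinearMap.ker (T ^ n - 1) :=
    span_range_eq_of_rank_le hv.linearIndependent (fun i => by simp [hTv]) (by simpa using hT)
  exact norm_apply_eq_of_mem_span hv hc hSv (hspan ▸ by simp [hx])

end Invariance

section ClockShift

/-- The orthonormal basis `f` puts the pair `(S, T)` in its normal form: `S` acts on it as the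
clock matrix, and `T` shifts it cyclically (addition in `Fin n` is modulo `n`). -/
def IsClockShiftBasis {V : Type*} [NormedAddCommGroup V] [InnerProductSpace ℂ V] {n : ℕ}
    [NeZero n] (S T : V →ₗ[ℂ] V) (f : OrthonormalBasis (Fin n) ℂ V) : Prop :=
  IsRootOfUnityEigenbasis S f ∧ ∀ k, T (f k) = f (k + 1)

theorem isPrimitiveRoot_rootOfUnity (n : ℕ) [NeZero n] : IsPrimitiveRoot (rootOfUnity n) n :=
  Complex.isPrimitiveRoot_exp n (NeZero.ne n)

theorem rootOfUnity_pow_pow_eq_one {n : ℕ} [NeZero n] (k : ℕ) : (rootOfUnity n ^ k) ^ n = 1 := by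
  rw [pow_right_comm, (isPrimitiveRoot_rootOfUnity n).pow_eq_one, one_pow]

theorem rootOfUnity_pow_val_injective (n : ℕ) [NeZero n] :
    Function.Injective fun k : Fin n => rootOfUnity n ^ (k : ℕ) :=
  fun i j hij => Fin.ext ((isPrimitiveRoot_rootOfUnity n).pow_inj i.2 j.2 hij)

theorem val_add_one_eq_mod {n : ℕ} [NeZero n] (k : Fin n) :
    ((k + 1 : Fin n) : ℕ) = ((k : ℕ) + 1) % n := by
  simp [Fin.val_add]

theorem pow_val_add_one {M : Type*} [Monoid M] {n : ℕ} [NeZero n] {r : M} (hr : r ^ n = 1)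
    (k : Fin n) : r ^ ((k + 1 : Fin n) : ℕ) = r ^ ((k : ℕ) + 1) := by
  rw [val_add_one_eq_mod, ← pow_eq_pow_mod _ hr]

variable {V : Type*} [NormedAddCommGroup V] [InnerProductSpace ℂ V] {n : ℕ}

theorem repr_apply_eq_toEuclideanLin {S : V →ₗ[ℂ] V} {f : OrthonormalBasis (Fin n) ℂ V}
    {M : Matrix (Fin n) (Fin n) ℂ} (h : ∀ j k, f.repr (S (f k)) j = M j k) (v : V) :
    f.repr (S v) = Matrix.toEuclideanLin M (f.repr v) := by
  have hM : LinearMap.toMatrix f.toBasis f.toBasis S = M := by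
    ext j k
    simp [LinearMap.toMatrix_apply, h]
  ext j
  have hj := congrFun (LinearMap.toMatrix_mulVec_repr f.toBasis f.toBasis S v) j
  rw [hM] at hj
  simpa [Matrix.toLpLin_apply, Matrix.mulVec, dotProduct] using hj.symm

theorem IsRootOfUnityEigenbasis.repr_apply_eq {S : V →ₗ[ℂ] V} {f : OrthonormalBasis (Fin n) ℂ V}
    (h : IsRootOfUnityEigenbasis S f) (v : V) (j : Fin n) :
    f.repr (S v) j = rootOfUnity n ^ (j : ℕ) * f.repr v j := by
  conv_lhs => rw [← f.sum_repr v]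
  simp [h _, Pi.single_apply, mul_comm]

variable [NeZero n] {S T : V →ₗ[ℂ] V} {f : OrthonormalBasis (Fin n) ℂ V}

theorem IsClockShiftBasis.pairUnitarilyEquivalent (h : IsClockShiftBasis S T f) :
    PairUnitarilyEquivalent S T (clockMatrix n) (shiftMatrix n) := by
  refine ⟨f.repr, repr_apply_eq_toEuclideanLin fun j k => ?_,
    repr_apply_eq_toEuclideanLin fun j k => ?_⟩
  · by_cases hjk : j = k <;> simp [h.1 k, clockMatrix, hjk]
  · simp [h.2 k, shiftMatrix, Fin.ext_iff, Fin.val_add]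

theorem exists_orthonormalBasis_span_coe_eq {ι 𝕜 E : Type*} [RCLike 𝕜] [NormedAddCommGroup E]
    [InnerProductSpace 𝕜 E] [Fintype ι] {v : ι → E} (hv : Orthonormal 𝕜 v) :
    ∃ f : OrthonormalBasis ι 𝕜 (Submodule.span 𝕜 (Set.range v)), ∀ i, (f i : E) = v i := by
  let b := Module.Basis.span hv.linearIndependent
  have hb (i : ι) : (b i : E) = v i := congrArg Subtype.val (Module.Basis.span_apply _ i)
  have hb_orthonormal : Orthonormal 𝕜 b :=
    (Submodule.subtypeₗᵢ _).orthonormal_comp_iff.1 (by convert hv using 1; exact funext hb)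
  exact ⟨b.toOrthonormalBasis hb_orthonormal, fun i => by simp [hb]⟩

theorem exists_isClockShiftBasis_restrict {v : Fin n → V} (hv : Orthonormal ℂ v)
    (hSv : ∀ k, S (v k) = rootOfUnity n ^ (k : ℕ) • v k) (hTv : ∀ k, T (v k) = v (k + 1)) :
    ∃ (L : Submodule ℂ V) (hSL : ∀ x ∈ L, S x ∈ L) (hTL : ∀ x ∈ L, T x ∈ L)
      (f : OrthonormalBasis (Fin n) ℂ L),
      IsClockShiftBasis (S.restrict hSL) (T.restrict hTL) f := by
  let L := Submodule.span ℂ (Set.range v)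
  obtain ⟨f, hf⟩ : ∃ f : OrthonormalBasis (Fin n) ℂ L, ∀ k, (f k : V) = v k :=
    exists_orthonormalBasis_span_coe_eq hv
  have hmem (k : Fin n) : v k ∈ L := Submodule.subset_span ⟨k, rfl⟩
  have hSL : L ≤ L.comap S := Submodule.span_le.2 <| Set.range_subset_iff.2 fun k => by
    simpa [hSv] using L.smul_mem _ (hmem k)
  have hTL : L ≤ L.comap T := Submodule.span_le.2 <| Set.range_subset_iff.2 fun k => by
    simpa [hTv] using hmem (k + 1)
  exact ⟨L, hSL, hTL, f, fun k => Subtype.ext (by simp [hf, hSv]),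
    fun k => Subtype.ext (by simp [hf, hTv])⟩

theorem exists_ne_zero_apply_eq_smul_of_apply_eq_add_one {K W : Type*} [Field K] [AddCommGroup W]
    [Module K W] {T : W →ₗ[K] W} {v : Fin n → W} (hv : LinearIndependent K v)
    (hT : ∀ k, T (v k) = v (k + 1)) {r : K} (hr : r ^ n = 1) : ∃ z ≠ 0, T z = r • z := by
  have hr₀ : r ≠ 0 := by rintro rfl; simp [NeZero.ne n] at hr
  refine ⟨∑ k : Fin n, r⁻¹ ^ (k : ℕ) • v k, fun hz => ?_, ?_⟩
  · simpa using Fintype.linearIndependent_iff.1 hv _ hz 0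
  · calc T (∑ k : Fin n, r⁻¹ ^ (k : ℕ) • v k)
        = ∑ k : Fin n, r⁻¹ ^ (k : ℕ) • v (k + 1) := by simp [hT]
      _ = ∑ k : Fin n, r • r⁻¹ ^ ((k + 1 : Fin n) : ℕ) • v (k + 1) := by
        congr! 1 with k
        rw [pow_val_add_one (by simp [hr]), pow_succ', smul_smul, mul_inv_cancel_left₀ hr₀]
      _ = r • ∑ k : Fin n, r⁻¹ ^ (k : ℕ) • v k := by
        rw [Finset.smul_sum]
        exact Equiv.sum_comp (Equiv.addRight (1 : Fin n)) fun k => r • r⁻¹ ^ (k : ℕ) • v k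

theorem orthonormal_of_isometry_apply_eq_smul {ι 𝕜 E : Type*} [RCLike 𝕜] [NormedAddCommGroup E]
    [InnerProductSpace 𝕜 E] {U : E →ₗᵢ[𝕜] E} {v : ι → E} {c : ι → 𝕜}
    (hc : Function.Injective c) (hv : ∀ i, ‖v i‖ = 1) (hU : ∀ i, U (v i) = c i • v i) :
    Orthonormal 𝕜 v := by
  refine ⟨hv, fun i j hij => ?_⟩
  have hci : c i * (starRingEnd 𝕜) (c i) = 1 := by
    have := congrArg norm (hU i)
    rw [U.norm_map, norm_smul, hv, mul_one] at this
    simp [RCLike.mul_conj, ← this]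
  have hinner := U.inner_map_map (v i) (v j)
  rw [hU, hU, inner_smul_left, inner_smul_right] at hinner
  have hzero : (c j - c i) * inner 𝕜 (v i) (v j) = 0 := by
    linear_combination c i * hinner - c j * inner 𝕜 (v i) (v j) * hci
  exact (mul_eq_zero.1 hzero).resolve_left (sub_ne_zero.2 (hc.ne hij.symm))

theorem IsClockShiftBasis.exists_isRootOfUnityEigenbasis (h : IsClockShiftBasis S T f) :
    ∃ ζ : OrthonormalBasis (Fin n) ℂ V, IsRootOfUnityEigenbasis T ζ := by
  let U : V ≃ₗᵢ[ℂ] V := f.equiv f (Equiv.addRight 1)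
  have hU : T = U.toLinearEquiv.toLinearMap := f.toBasis.ext fun k => by simp [U, h.2 k]
  have heigen (j : Fin n) : ∃ z : V, ‖z‖ = 1 ∧ T z = rootOfUnity n ^ (j : ℕ) • z := by
    obtain ⟨z, hz₀, hz⟩ := exists_ne_zero_apply_eq_smul_of_apply_eq_add_one
      f.orthonormal.linearIndependent h.2 (r := rootOfUnity n ^ (j : ℕ))
      (rootOfUnity_pow_pow_eq_one j)
    exact ⟨(‖z‖⁻¹ : ℂ) • z, by simp [norm_smul, hz₀], by rw [map_smul, hz, smul_comm]⟩
  choose ζ hζ_norm hζ using heigen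
  have hζ_orthonormal : Orthonormal ℂ ζ :=
    orthonormal_of_isometry_apply_eq_smul (U := U.toLinearIsometry)
      (rootOfUnity_pow_val_injective n) hζ_norm fun j => by simpa [hU] using hζ j
  have : FiniteDimensional ℂ V := f.toBasis.finiteDimensional_of_finite
  have hspan := hζ_orthonormal.linearIndependent.span_eq_top_of_card_eq_finrank'
    (Module.finrank_eq_card_basis f.toBasis).symm
  exact ⟨OrthonormalBasis.mk hζ_orthonormal hspan.ge, fun j => by simpa using hζ j⟩

theorem IsRootOfUnityEigenbasis.exists_eq_smul {e : OrthonormalBasis (Fin n) ℂ V}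
    (he : IsRootOfUnityEigenbasis S e) (hf : IsRootOfUnityEigenbasis S f) (k : Fin n) :
    ∃ b : ℂ, ‖b‖ = 1 ∧ e k = b • f k := by
  have hzero (j : Fin n) (hjk : j ≠ k) : f.repr (e k) j = 0 := by
    have hrepr := hf.repr_apply_eq (e k) j
    rw [he k, map_smul, PiLp.smul_apply, smul_eq_mul] at hrepr
    by_contra hne
    exact hjk (rootOfUnity_pow_val_injective n (mul_right_cancel₀ hne hrepr.symm))
  have hek : e k = f.repr (e k) k • f k := by
    conv_lhs => rw [← f.sum_repr (e k)]
    exact Finset.sum_eq_single k (fun j _ hjk => by rw [hzero j hjk, zero_smul]) (by simp)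
  refine ⟨_, ?_, hek⟩
  simpa [norm_smul] using (congrArg norm hek).symm

variable {ζ : OrthonormalBasis (Fin n) ℂ V}

theorem IsClockShiftBasis.repr_eq (h : IsClockShiftBasis S T f) (hζ : IsRootOfUnityEigenbasis T ζ)
    (j k : Fin n) :
    ζ.repr (f k) j = rootOfUnity n ^ ((j : ℕ) * (k : ℕ)) * ζ.repr (f 0) j := by
  have hrepr (m : ℕ) :
      ζ.repr (f (Fin.ofNat n m)) j = rootOfUnity n ^ ((j : ℕ) * m) * ζ.repr (f 0) j := by
    induction m with
    | zero => simp
    | succ m ih =>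
      have hsucc : Fin.ofNat n (m + 1) = Fin.ofNat n m + 1 := by ext; simp [Fin.val_add]
      rw [hsucc, ← h.2, hζ.repr_apply_eq, ih, mul_add_one, pow_add]
      ring
  simpa using hrepr k

theorem IsClockShiftBasis.norm_sqrt_mul_repr_zero (h : IsClockShiftBasis S T f)
    (hζ : IsRootOfUnityEigenbasis T ζ) (j : Fin n) :
    ‖(Real.sqrt n : ℂ) * ζ.repr (f 0) j‖ = 1 := by
  have hω : ‖rootOfUnity n‖ = 1 := (isPrimitiveRoot_rootOfUnity n).norm'_eq_one (NeZero.ne n)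
  have hcoeff (k : Fin n) : ‖inner ℂ (ζ j) (f k)‖ = ‖ζ.repr (f 0) j‖ := by
    rw [← ζ.repr_apply_apply, h.repr_eq hζ, norm_mul, norm_pow, hω, one_pow, one_mul]
  have hsum : n * ‖ζ.repr (f 0) j‖ ^ 2 = 1 := by
    simpa [hcoeff] using f.sum_sq_norm_inner_left (ζ j)
  rw [← sq_eq_sq₀ (norm_nonneg _) zero_le_one, norm_mul, mul_pow, Complex.norm_real,
    Real.norm_of_nonneg (Real.sqrt_nonneg _), Real.sq_sqrt n.cast_nonneg, hsum, one_pow]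

theorem IsClockShiftBasis.exists_transitionMatrix_eq (h : IsClockShiftBasis S T f)
    {e : OrthonormalBasis (Fin n) ℂ V} (he : IsRootOfUnityEigenbasis S e)
    (hζ : IsRootOfUnityEigenbasis T ζ) :
    ∃ a b : Fin n → ℂ, (∀ j, ‖a j‖ = 1) ∧ (∀ j, ‖b j‖ = 1) ∧
      (Real.sqrt n : ℂ) • transitionMatrix e ζ =
        Matrix.diagonal a * fourierMatrix n * Matrix.diagonal b := by
  choose b hb hef using he.exists_eq_smul h.1
  refine ⟨fun j => Real.sqrt n * ζ.repr (f 0) j, b, h.norm_sqrt_mul_repr_zero hζ, hb, ?_⟩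
  ext j k
  rw [Matrix.mul_diagonal, Matrix.diagonal_mul, Matrix.smul_apply, transitionMatrix,
    fourierMatrix, Matrix.of_apply, Matrix.of_apply, smul_eq_mul, hef, map_smul, PiLp.smul_apply,
    smul_eq_mul, h.repr_eq hζ]
  ring

end ClockShift

section CyclicEigenvectors

theorem norm_pow_apply_eq_one_and_apply_pow_apply_eq_smul {K V : Type*} [Semiring K]
    [NormedAddCommGroup V] [Module K V] {S T : Module.End K V} {ω : K} {n : ℕ} (hω : ω ^ n = 1)
    (hstep : ∀ (μ : K) (e : V), μ ^ n = 1 → ‖e‖ = 1 → S e = μ • e →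
      ‖T e‖ = 1 ∧ S (T e) = (ω * μ) • T e)
    {g : V} (hg : ‖g‖ = 1) (hSg : S g = g) (k : ℕ) :
    ‖(T ^ k) g‖ = 1 ∧ S ((T ^ k) g) = ω ^ k • (T ^ k) g := by
  induction k with
  | zero => simp [hg, hSg]
  | succ k ih =>
    rw [pow_succ', pow_succ', Module.End.mul_apply]
    exact hstep _ _ (by rw [pow_right_comm, hω, one_pow]) ih.1 ih.2

variable {H : Type*} [NormedAddCommGroup H] [InnerProductSpace ℂ H] [CompleteSpace H]
  {A B : H →L[ℂ] H} [IsStarNormal A] {n : ℕ} {μ : ℂ} {e : H}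

theorem isSimpleFixedPair_innerSL_of_apply_eq_smul (hμ : μ ≠ 0)
    (hmult : IsIsolatedSpectralPointOfMultiplicity (μ⁻¹ • A) 1 1) (he : ‖e‖ = 1)
    (hAe : A e = μ • e) : IsSimpleFixedPair (μ⁻¹ • A) (innerSL ℂ e) e := by
  have hnormal : IsStarNormal (μ⁻¹ • A) := IsStarNormal.smul _ A
  exact isSimpleFixedPair_innerSL hmult.eventually_eq (by simpa using hmult.rank_eigenspace_le) he
    (by simp [hAe, hμ])

theorem exists_norm_eq_one_apply_eq_smul_of_multiplicity (hμ : μ ≠ 0) {m : ℕ}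
    (hmult : IsIsolatedSpectralPointOfMultiplicity (μ⁻¹ • A) 1 m) :
    ∃ e : H, ‖e‖ = 1 ∧ A e = μ • e := by
  have hnormal : IsStarNormal (μ⁻¹ • A) := IsStarNormal.smul _ A
  obtain ⟨e, he, hAe⟩ := exists_norm_eq_one_apply_eq_smul hmult.mem_spectrum hmult.eventually_eq
  exact ⟨e, he, by simpa [inv_smul_eq_iff₀ hμ] using hAe⟩

variable [NeZero n]
  (hspec : ∀ x : ℂ, x ^ n = 1 → ∀ᶠ p in 𝓝 ![x, 0, 0, 0], p ∈ fourierSurface n →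
    p ∈ properJointSpectrum ![A, B, A * B, B * A])
  (hA : ∀ x : ℂ, x ^ n = 1 → IsIsolatedSpectralPointOfMultiplicity (x • A) 1 1)

include hspec hA

theorem inner_pow_apply_eq_of_apply_eq_smul (hμ : μ ^ n = 1) (he : ‖e‖ = 1)
    (hAe : A e = μ • e) :
    inner ℂ e ((B ^ n) e) = (1 : ℂ) ∧
      inner ℂ e ((B ^ (n - 1)) (A (B e))) = rootOfUnity n * μ := by
  have hn := NeZero.ne n
  have hμ₀ : μ ≠ 0 := ne_zero_pow hn (hμ ▸ one_ne_zero)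
  have hx : μ⁻¹ ^ n = 1 := by rw [inv_pow, hμ, inv_one]
  have hpair := isSimpleFixedPair_innerSL_of_apply_eq_smul hμ₀ (hA _ hx) he hAe
  have hpow : μ⁻¹ ^ (n - 1) = μ := by
    rw [← mul_left_inj' (inv_ne_zero hμ₀), pow_sub_one_mul hn, hx, mul_inv_cancel₀ hμ₀]
  have hAB := hpair.apply_pow_sub_one_apply_eq hn hx (hspec _ hx)
  rw [hpow, mul_comm] at hAB
  exact ⟨hpair.apply_pow_eq_one hn hx (hspec _ hx), hAB⟩

variable (hB : ‖B‖ ≤ 1)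
  (hBrank : ∀ x : ℂ, x ^ n = 1 → Module.rank ℂ (Module.End.eigenspace B.toLinearMap x) ≤ 1)

include hB hBrank

theorem norm_apply_eq_norm_of_pow_apply_eq_self {x : H} (hx : (B ^ n) x = x) : ‖A x‖ = ‖x‖ := by
  have hω := isPrimitiveRoot_rootOfUnity n
  have hroot (j : Fin n) : (rootOfUnity n ^ (j : ℕ)) ^ n = 1 := rootOfUnity_pow_pow_eq_one j
  have heigen (j : Fin n) : ∃ v : H, ‖v‖ = 1 ∧ A v = rootOfUnity n ^ (j : ℕ) • v :=
    exists_norm_eq_one_apply_eq_smul_of_multiplicity (ne_zero_pow (NeZero.ne n) (by simp [hroot]))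
      (hA _ (by rw [inv_pow, hroot, inv_one]))
  choose v hv hAv using heigen
  have hv_orthonormal : Orthonormal ℂ v :=
    orthonormal_of_apply_eq_smul (rootOfUnity_pow_val_injective n) hv hAv
  have hBv (j : Fin n) : (B ^ n) (v j) = v j := pow_apply_eq_self_of_inner_eq_one hB (hv j)
    (inner_pow_apply_eq_of_apply_eq_smul hspec hA (hroot j) (hv j) (hAv j)).1
  refine norm_apply_eq_of_rank_ker_pow_sub_one_le (S := A.toLinearMap) (T := B.toLinearMap)
    (rank_ker_pow_sub_one_le (NeZero.ne n) hω hBrank) hv_orthonormal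
    (fun j => Complex.norm_eq_one_of_pow_eq_one (hroot j) (NeZero.ne n)) hAv ?_ ?_
  · simpa [← ContinuousLinearMap.toLinearMap_pow] using hBv
  · simpa [← ContinuousLinearMap.toLinearMap_pow] using hx

theorem norm_apply_eq_one_and_apply_apply_eq_smul (hμ : μ ^ n = 1) (he : ‖e‖ = 1)
    (hAe : A e = μ • e) : ‖B e‖ = 1 ∧ A (B e) = (rootOfUnity n * μ) • B e := by
  have hn := NeZero.ne n
  obtain ⟨hinner, hinnerA⟩ := inner_pow_apply_eq_of_apply_eq_smul hspec hA hμ he hAe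
  have hBe : ‖B e‖ = 1 := norm_apply_eq_one_of_inner_pow_apply_eq_one hn hB he hinner
  have hBBe : (B ^ n) (B e) = B e := by
    rw [← mul_apply_eq_comp, ← pow_succ, pow_succ', mul_apply_eq_comp,
      pow_apply_eq_self_of_inner_eq_one hB he hinner]
  have hABe : ‖A (B e)‖ = 1 :=
    (norm_apply_eq_norm_of_pow_apply_eq_self hspec hA hB hBrank hBBe).trans hBe
  have hroot : (rootOfUnity n * μ) ^ n = 1 := by
    rw [mul_pow, hμ, (isPrimitiveRoot_rootOfUnity n).pow_eq_one, one_mul]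
  exact ⟨hBe, apply_apply_eq_smul_of_inner_eq hn hB he hinner hABe.le
    (Complex.norm_eq_one_of_pow_eq_one hroot hn) hinnerA⟩

theorem exists_orthonormal_clock_shift : ∃ v : Fin n → H, Orthonormal ℂ v ∧
    (∀ k, A (v k) = rootOfUnity n ^ (k : ℕ) • v k) ∧ ∀ k, B (v k) = v (k + 1) := by
  have hω := isPrimitiveRoot_rootOfUnity n
  obtain ⟨g, hg, hAg⟩ : ∃ g : H, ‖g‖ = 1 ∧ A g = (1 : ℂ) • g :=
    exists_norm_eq_one_apply_eq_smul_of_multiplicity one_ne_zero (hA _ (by simp))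
  have hBg : (B ^ n) g = g := pow_apply_eq_self_of_inner_eq_one hB hg
    (inner_pow_apply_eq_of_apply_eq_smul hspec hA (one_pow n) hg hAg).1
  have horbit (k : ℕ) : ‖(B ^ k) g‖ = 1 ∧ A ((B ^ k) g) = rootOfUnity n ^ k • (B ^ k) g := by
    have := norm_pow_apply_eq_one_and_apply_pow_apply_eq_smul (S := A.toLinearMap)
      (T := B.toLinearMap) hω.pow_eq_one
      (fun μ e hμ he hAe => norm_apply_eq_one_and_apply_apply_eq_smul hspec hA hB hBrank hμ he hAe)
      hg (by simpa using hAg) k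
    simpa [← ContinuousLinearMap.toLinearMap_pow] using this
  refine ⟨fun k => (B ^ (k : ℕ)) g, orthonormal_of_apply_eq_smul
    (rootOfUnity_pow_val_injective n) (fun k => (horbit k).1) fun k => (horbit k).2,
    fun k => (horbit k).2, fun k => ?_⟩
  have hperiodic : Function.IsPeriodicPt B n g := by
    rwa [FunLike.coe_pow_eq_iterate] at hBg
  change B ((B ^ (k : ℕ)) g) = (B ^ ((k + 1 : Fin n) : ℕ)) g
  rw [val_add_one_eq_mod, FunLike.coe_pow_eq_iterate, FunLike.coe_pow_eq_iterate,
    hperiodic.iterate_mod_apply, Function.iterate_succ_apply']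

end CyclicEigenvectors

section Reduction

theorem polydisk_mem_nhds {k : ℕ} (τ : Fin k → ℂ) {ε : ℝ} (hε : 0 < ε) : polydisk τ ε ∈ 𝓝 τ := by
  filter_upwards [Metric.ball_mem_nhds τ hε] with w hw i
  exact (norm_le_pi_norm (w - τ) i).trans_lt (mem_ball_iff_norm.1 hw)

theorem eventually_mem_of_inter_polydisk_eq {k : ℕ} {s t : Set (Fin k → ℂ)} {τ : Fin k → ℂ}
    {ε : ℝ} (hε : 0 < ε) (h : s ∩ polydisk τ ε = t ∩ polydisk τ ε) :
    ∀ᶠ p in 𝓝 τ, p ∈ t → p ∈ s := by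
  filter_upwards [polydisk_mem_nhds τ hε] with p hp hpt
  exact (h.ge ⟨hpt, hp⟩).1

theorem mem_fourierSurface_fst {n : ℕ} [NeZero n] {x : ℂ} (hx : x ^ n = 1) :
    ![x, 0, 0, 0] ∈ fourierSurface n := by
  simp [fourierSurface, hx, NeZero.ne n]

theorem mem_fourierSurface_snd {n : ℕ} [NeZero n] {x : ℂ} (hx : x ^ n = 1) :
    ![0, x, 0, 0] ∈ fourierSurface n := by
  simp [fourierSurface, hx, NeZero.ne n]

theorem forall_rootOfUnity_pow_iff {n : ℕ} [NeZero n] {P : ℂ → Prop} :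
    (∀ j : Fin n, P (rootOfUnity n ^ (j : ℕ))) ↔ ∀ x : ℂ, x ^ n = 1 → P x := by
  refine ⟨fun h x hx => ?_, fun h j => h _ (rootOfUnity_pow_pow_eq_one j)⟩
  obtain ⟨i, hi, rfl⟩ := (isPrimitiveRoot_rootOfUnity n).eq_pow_of_pow_eq_one hx
  exact h ⟨i, hi⟩

variable {H : Type*} [NormedAddCommGroup H] [InnerProductSpace ℂ H] {A B : H →L[ℂ] H} {x : ℂ}
  {m : ℕ}

theorem hasJointMultiplicity_fst_iff :
    HasJointMultiplicity ![A, B, A * B, B * A] ![x, 0, 0, 0] m ↔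
      IsIsolatedSpectralPointOfMultiplicity (x • A) 1 m := by
  simp [HasJointMultiplicity, Fin.sum_univ_four]

theorem hasJointMultiplicity_snd_iff :
    HasJointMultiplicity ![A, B, A * B, B * A] ![0, x, 0, 0] m ↔
      IsIsolatedSpectralPointOfMultiplicity (x • B) 1 m := by
  simp [HasJointMultiplicity, Fin.sum_univ_four]

theorem eigenspace_le_eigenspace_inv_smul_one (hx : x ≠ 0) :
    Module.End.eigenspace B.toLinearMap x ≤
      Module.End.eigenspace (x⁻¹ • B).toLinearMap 1 := by
  intro v hv
  have hBv : B v = x • v := Module.End.mem_eigenspace_iff.1 hv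
  simp [hBv, hx]

end Reduction

theorem mainTheorem3_general {H : Type*} [NormedAddCommGroup H] [InnerProductSpace ℂ H]
    [CompleteSpace H] (A B : H →L[ℂ] H) (hA : IsStarNormal A) (hB : ‖B‖ ≤ 1)
    (n : ℕ) (hn : 1 ≤ n)
    (hspec : ∀ x : ℂ, x ^ n = 1 → ∀ᶠ p in 𝓝 ![x, 0, 0, 0],
      p ∈ fourierSurface n → p ∈ properJointSpectrum ![A, B, A * B, B * A])
    (hAmult : ∀ x : ℂ, x ^ n = 1 → IsIsolatedSpectralPointOfMultiplicity (x • A) 1 1)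
    (hBrank : ∀ x : ℂ, x ^ n = 1 →
      Module.rank ℂ (Module.End.eigenspace (x • B).toLinearMap 1) ≤ 1) :
    ∃ (L : Submodule ℂ H) (hAL : ∀ v ∈ L, A v ∈ L) (hBL : ∀ v ∈ L, B v ∈ L),
      Module.finrank ℂ L = n ∧
      PairUnitarilyEquivalent (A.toLinearMap.restrict hAL) (B.toLinearMap.restrict hBL)
        (clockMatrix n) (shiftMatrix n) ∧
      (∃ e : OrthonormalBasis (Fin n) ℂ L,
        IsRootOfUnityEigenbasis (A.toLinearMap.restrict hAL) e) ∧
      (∃ ζ : OrthonormalBasis (Fin n) ℂ L,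
        IsRootOfUnityEigenbasis (B.toLinearMap.restrict hBL) ζ) ∧
      ∀ e ζ : OrthonormalBasis (Fin n) ℂ L,
        IsRootOfUnityEigenbasis (A.toLinearMap.restrict hAL) e →
        IsRootOfUnityEigenbasis (B.toLinearMap.restrict hBL) ζ →
        ∃ a b : Fin n → ℂ, (∀ j, ‖a j‖ = 1) ∧ (∀ j, ‖b j‖ = 1) ∧
          (Real.sqrt n : ℂ) • transitionMatrix e ζ =
            Matrix.diagonal a * fourierMatrix n * Matrix.diagonal b := by
  have : NeZero n := NeZero.of_pos hn
  have hBrank' (x : ℂ) (hx : x ^ n = 1) :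
      Module.rank ℂ (Module.End.eigenspace B.toLinearMap x) ≤ 1 :=
    (Submodule.rank_mono (eigenspace_le_eigenspace_inv_smul_one
      (ne_zero_pow (NeZero.ne n) (hx ▸ one_ne_zero)))).trans
      (hBrank x⁻¹ (by rw [inv_pow, hx, inv_one]))
  obtain ⟨v, hv, hAv, hBv⟩ := exists_orthonormal_clock_shift hspec hAmult hB hBrank'
  obtain ⟨L, hAL, hBL, f, hf⟩ := exists_isClockShiftBasis_restrict
    (S := A.toLinearMap) (T := B.toLinearMap) hv hAv hBv
  exact ⟨L, hAL, hBL, by simpa using Module.finrank_eq_card_basis f.toBasis,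
    hf.pairUnitarilyEquivalent, ⟨f, hf.1⟩, hf.exists_isRootOfUnityEigenbasis,
    fun e ζ he hζ => hf.exists_transitionMatrix_eq he hζ⟩


theorem mainTheorem3 {H : Type*} [NormedAddCommGroup H] [InnerProductSpace ℂ H] [CompleteSpace H]
    (A B : H →L[ℂ] H) (hA : IsStarNormal A) (hB : ‖B‖ = 1)
    (n : ℕ) (hn : 1 ≤ n) (ε : ℝ) (hε : 0 < ε)
    (hspec : ∀ j : Fin n,
      ∀ τ ∈ ({![rootOfUnity n ^ (j : ℕ), 0, 0, 0], ![0, rootOfUnity n ^ (j : ℕ), 0, 0]} :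
        Set (Fin 4 → ℂ)),
        properJointSpectrum ![A, B, A * B, B * A] ∩ polydisk τ ε =
          fourierSurface n ∩ polydisk τ ε)
    (hmult : ∀ j : Fin n,
      ∀ τ ∈ ({![rootOfUnity n ^ (j : ℕ), 0, 0, 0], ![0, rootOfUnity n ^ (j : ℕ), 0, 0]} :
        Set (Fin 4 → ℂ)),
        ∀ x ∈ fourierSurface n ∩ polydisk τ ε,
          HasJointMultiplicity ![A, B, A * B, B * A] x 1) :
    ∃ (L : Submodule ℂ H) (hAL : ∀ v ∈ L, A v ∈ L) (hBL : ∀ v ∈ L, B v ∈ L),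
      Module.finrank ℂ L = n ∧
      PairUnitarilyEquivalent (A.toLinearMap.restrict hAL) (B.toLinearMap.restrict hBL)
        (clockMatrix n) (shiftMatrix n) ∧
      (∃ e : OrthonormalBasis (Fin n) ℂ L,
        IsRootOfUnityEigenbasis (A.toLinearMap.restrict hAL) e) ∧
      (∃ ζ : OrthonormalBasis (Fin n) ℂ L,
        IsRootOfUnityEigenbasis (B.toLinearMap.restrict hBL) ζ) ∧
      ∀ e ζ : OrthonormalBasis (Fin n) ℂ L,
        IsRootOfUnityEigenbasis (A.toLinearMap.restrict hAL) e →
        IsRootOfUnityEigenbasis (B.toLinearMap.restrict hBL) ζ →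
        ∃ a b : Fin n → ℂ, (∀ j, ‖a j‖ = 1) ∧ (∀ j, ‖b j‖ = 1) ∧
          (Real.sqrt n : ℂ) • transitionMatrix e ζ =
            Matrix.diagonal a * fourierMatrix n * Matrix.diagonal b := by
  have : NeZero n := NeZero.of_pos hn
  have hcenter (j : Fin n) (τ) (hτ) (hτS : τ ∈ fourierSurface n) :=
    hmult j τ hτ τ ⟨hτS, mem_of_mem_nhds (polydisk_mem_nhds τ hε)⟩
  refine mainTheorem3_general A B hA hB.le n hn ?_ ?_ ?_ <;>
    refine forall_rootOfUnity_pow_iff.1 fun j => ?_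
  · exact eventually_mem_of_inter_polydisk_eq hε (hspec j _ (Or.inl rfl))
  · exact hasJointMultiplicity_fst_iff.1
      (hcenter j _ (Or.inl rfl) (mem_fourierSurface_fst (rootOfUnity_pow_pow_eq_one j)))
  · simpa using (hasJointMultiplicity_snd_iff.1 (hcenter j _ (Or.inr rfl)
      (mem_fourierSurface_snd (rootOfUnity_pow_pow_eq_one j)))).rank_eigenspace_le
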